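/- Let $\mathcal H$ be a real Hilbert space with identity $\mathrm{Id}$. A set-valued operator $A\colon\mathcal H\to 2^{\mathcal H}$ is monotone if $\langle u-v,x-y\rangle\ge 0$ whenever $u\in Ax$, $v\in Ay$, and maximally monotone if moreover its graph is not properly contained in the graph of another monotone operator; $\operatorname{zer}A=\{x\mid 0\in Ax\}$. For $\beta>0$, $C\colon\mathcal H\to\mathcal H$ is $\beta^{-1}$-cocoercive if $\langle Cx-Cy,x-y\rangle\ge\beta^{-1}\|Cx-Cy\|^2$ for all $x,y\in\mathcal H$; if $C=0$, the value $\beta=\beta^{-1}=0$ is also allowed. (i) Let $B\colon\mathcal H\to 2^{\mathcal H}$ be maximally monotone, let $D\colon\mathcal H\to\mathcal H$ be $\delta$-Lipschitz continuous with $\delta\ge 0$ and such that $B+D$ is maximally monotone, let $C\colon\mathcal H\to\mathcal H$ be $\beta^{-1}$-cocoercive, and suppose $\operatorname{zer}(B+D+C)\ne\emptyset$. Let $\theta<1$, $\alpha_{-1}>0$, $x_{-1},x_0\in\mathcal H$, and let $(x_k)$ be generated by forward-half-reflected-backward splitting with momentum: for all $k\in\mathbb N=\{0,1,\dots\}$,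 $$\bar x_k=x_k+\theta(x_k-x_{k-1}),\qquad x_{k+1}=(\mathrm{Id}+\alpha_kB)^{-1}\bigl(\bar x_k-\alpha_kCx_k-(\alpha_k+\alpha_{k-1})Dx_k+\alpha_{k-1}Dx_{k-1}\bigr).$$ If there exists $\varepsilon>0$ such that $$\varepsilon\le\alpha_k,\qquad \alpha_k\delta+\alpha_{k+1}\bigl(\delta+\tfrac{\beta}{2}\bigr)\le(1-\theta-2|\theta|)-\varepsilon\qquad\text{for all }k\in\mathbb N,$$ then $x_k\rightharpoonup x^\star$ for some solution $x^\star$ of $0\in Bx+Dx+Cx$. (ii) In particular, forward-backward splitting with momentum converges, for suitable step-sizes, for every $\theta\in(-1,\tfrac13)$: for every such $\theta$ and every $\beta\ge 0$ there is $\bar\alpha>0$ such that, whenever $B\colon\mathcal H\to 2^{\mathcal H}$ is maximally monotone, $C\colon\mathcal H\to\mathcal H$ is $\beta^{-1}$-cocoercive, $\operatorname{zer}(B+C)\neq\emptyset$, and the step-sizes satisfy $\inf_{k\in\mathbb N}\alpha_k>0$ and $\alpha_k\le\bar\alpha$ for all $k\in\mathbb N$, every sequence with $x_{-1},x_0\in\mathcal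 H$ and $$x_{k+1}=(\mathrm{Id}+\alpha_kB)^{-1}\bigl(x_k+\theta(x_k-x_{k-1})-\alpha_kCx_k\bigr),\qquad k\in\mathbb N,$$ converges weakly to some $x^\star\in\operatorname{zer}(B+C)$. -/

import Mathlib

open scoped NNReal Pointwise Topology

namespace FHRB

variable {H : Type*} [NormedAddCommGroup H] [InnerProductSpace ℝ H]

/-- The graph of a set-valued operator `A : H → 2^H`. -/
def graph (A : H → Set H) : Set (H × H) := {p | p.2 ∈ A p.1}

/-- Monotonicity of a set-valued operator. -/
def IsMonotone (A : H → Set H) : Prop :=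
  ∀ p ∈ graph A, ∀ q ∈ graph A, 0 ≤ inner ℝ (p.2 - q.2) (p.1 - q.1)

/-- Maximal monotonicity: `A` is monotone and its graph is not a proper subset of the graph of
another monotone operator. -/
def IsMaximallyMonotone (A : H → Set H) : Prop :=
  IsMonotone A ∧ ∀ A' : H → Set H, IsMonotone A' → ¬ graph A ⊂ graph A'

/-- The set-valued operator `x ↦ {F x}` of a single-valued operator `F : H → H`. -/
def toSetValued (F : H → H) : H → Set H := fun x => {F x}

/-- The set of zeros of a set-valued operator. -/
def zer (A : H → Set H) : Set H := {x | 0 ∈ A x}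

/-- The inverse of a set-valued operator: `x ∈ A⁻¹ y ↔ y ∈ A x`. -/
def inverse (A : H → Set H) : H → Set H := fun y => {x | y ∈ A x}

/-- The resolvent `(Id + a B)⁻¹`, as a set-valued operator. Sums and multiples of set-valued
operators are taken pointwise in the sense of Minkowski. -/
def resolvent (a : ℝ) (B : H → Set H) : H → Set H :=
  inverse (toSetValued id + fun x => a • B x)

/-- `C` is `β⁻¹`-cocoercive, with the convention that `β = β⁻¹ = 0` may (only) be taken when
`C = 0`. -/
def IsCocoercive (β : ℝ) (C : H → H) : Prop :=
  (0 < β ∧ ∀ x y, β⁻¹ * ‖C x - C y‖ ^ 2 ≤ inner ℝ (C x - C y) (x - y)) ∨ (β = 0 ∧ C = 0)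

/-- The standing assumptions on the operators of the inclusion `0 ∈ B x + D x + C x`. -/
structure Assumptions (B : H → Set H) (D C : H → H) (δ : ℝ≥0) (β : ℝ) : Prop where
  maximal_B : IsMaximallyMonotone B
  lipschitz_D : LipschitzWith δ D
  maximal_add : IsMaximallyMonotone (B + toSetValued D)
  cocoercive_C : IsCocoercive β C
  zer_nonempty : (zer (B + toSetValued D + toSetValued C)).Nonempty

/-- `x` (with `x (-1)` and `x 0` the arbitrary initial points) is generated by
forward-half-reflected-backward splitting with momentum `θ` and step-sizes `α`, including `α (-1)`.
Values of `x` and `α` at indices below `-1` play no role. -/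
def IsFHRBMomentum (B : H → Set H) (D C : H → H) (θ : ℝ) (α : ℤ → ℝ) (x : ℤ → H) : Prop :=
  ∀ k : ℕ, x (k + 1) ∈ resolvent (α k) B
    (x k + θ • (x k - x (k - 1)) - α k • C (x k)
      - (α k + α (k - 1)) • D (x k) + α (k - 1) • D (x (k - 1)))

/-- `x` (with `x (-1)` and `x 0` the arbitrary initial points) is generated by forward-backward
splitting with momentum `θ` and step-sizes `α`. -/
def IsFBMomentum (B : H → Set H) (C : H → H) (θ : ℝ) (α : ℕ → ℝ) (x : ℤ → H) : Prop :=
  ∀ k : ℕ, x (k + 1) ∈ resolvent (α k) B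
    (x k + θ • (x k - x (k - 1)) - α k • C (x k))

/-- Weak convergence of the sequence `x 0, x 1, x 2, …` to `z`. -/
def ConvergesWeakly (x : ℤ → H) (z : H) : Prop :=
  Filter.Tendsto (fun k : ℕ => toWeakSpace ℝ H (x k)) Filter.atTop (𝓝 (toWeakSpace ℝ H z))

end FHRB

/-! Write A = B + D, so solutions s satisfy -C s ∈ A s. For each s, the `energy` combines ‖xₖ₊₁ -
s‖² - θ‖xₖ - s‖² with a cross term from the reflected part of D and a multiple of ‖xₖ₊₁ - xₖ‖².
Monotonicity of A, cocoercivity of C and Young's inequality for the momentum and Lipschitz terms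
(`lyapunov_step`) make it drop by at least ε‖xₖ₊₂ - xₖ₊₁‖² per step; the step-size condition is
exactly what this needs.

The term -θ‖xₖ - s‖² may be negative, so boundedness of the iterates is proved first, by induction
from `mul_sq_norm_le`. The energy then converges, increments vanish, and ‖xₖ - s‖ converges. The
residual tends to 0 and C xₖ → C s strongly, so by weak-strong closedness of the graph of A every
weak cluster point is a solution. Opial's lemma, run with ultrafilters, concludes. -/

open Filter

namespace FHRB

variable {H : Type*} [NormedAddCommGroup H] [InnerProductSpace ℝ H]

/-! ### Set-valued operators, resolvents, cocoercivity -/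

/-- A point that is monotonically related to the graph of a maximally monotone operator belongs
to that graph. -/
theorem IsMaximallyMonotone.mem_of_forall {A : H → Set H} (hA : IsMaximallyMonotone A) {z u : H}
    (h : ∀ x, ∀ v ∈ A x, 0 ≤ inner ℝ (u - v) (z - x)) : u ∈ A z := by
  by_contra hu
  -- Adjoining the single point (z, u) to the graph keeps it monotone.
  refine hA.2 (fun x => A x ∪ {w | w = u ∧ x = z}) ?_ ?_
  · rintro ⟨x, v⟩ hp ⟨y, w⟩ hq
    rcases hp with hp | ⟨rfl, rfl⟩ <;> rcases hq with hq | ⟨rfl, rfl⟩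
    · exact hA.1 (x, v) hp (y, w) hq
    · have := h x v hp
      rwa [← inner_neg_neg, neg_sub, neg_sub] at this
    · exact h y w hq
    · simp
  · refine ⟨fun p hp => Or.inl hp, fun hsub => hu ?_⟩
    exact hsub (show (z, u) ∈ _ from Or.inr ⟨rfl, rfl⟩)

theorem mem_add_toSetValued {E : Type*} [NormedAddCommGroup E] {A : E → Set E} {F : E → E}
    {x u : E} :
    u ∈ (A + toSetValued F) x ↔ u - F x ∈ A x := by
  simp only [Pi.add_apply, toSetValued, Set.add_singleton, Set.mem_image]
  exact ⟨by rintro ⟨w, hw, rfl⟩; simpa using hw, fun h => ⟨_, h, by simp⟩⟩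

theorem mem_zer_add_toSetValued {E : Type*} [NormedAddCommGroup E] {A : E → Set E} {F : E → E}
    {x : E} :
    x ∈ zer (A + toSetValued F) ↔ -F x ∈ A x := by
  rw [← zero_sub, ← mem_add_toSetValued]
  rfl

theorem mem_resolvent {a : ℝ} {B : H → Set H} {y z : H} :
    y ∈ resolvent a B z ↔ ∃ u ∈ B y, a • u = z - y := by
  simp only [resolvent, inverse, Set.mem_ofPred_eq, Pi.add_apply, toSetValued, id,
    Set.singleton_add, Set.mem_image, Set.mem_smul_set]
  constructor
  · rintro ⟨_, ⟨u, hu, rfl⟩, rfl⟩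
    exact ⟨u, hu, by simp⟩
  · rintro ⟨u, hu, h⟩
    exact ⟨_, ⟨u, hu, rfl⟩, by simp [h]⟩

theorem IsCocoercive.nonneg {β : ℝ} {C : H → H} (hC : IsCocoercive β C) : 0 ≤ β := by
  rcases hC with h | h
  · exact h.1.le
  · exact h.1.ge

theorem IsCocoercive.sq_norm_sub_le {β : ℝ} {C : H → H} (hC : IsCocoercive β C) (x y : H) :
    ‖C x - C y‖ ^ 2 ≤ β * inner ℝ (C x - C y) (x - y) := by
  rcases hC with ⟨hβ, h⟩ | ⟨rfl, rfl⟩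
  · have := mul_le_mul_of_nonneg_left (h x y) hβ.le
    rwa [mul_inv_cancel_left₀ hβ.ne'] at this
  · simp

theorem IsCocoercive.norm_sub_le {β : ℝ} {C : H → H} (hC : IsCocoercive β C) (x y : H) :
    ‖C x - C y‖ ≤ β * ‖x - y‖ := by
  have h := (hC.sq_norm_sub_le x y).trans
    (mul_le_mul_of_nonneg_left (real_inner_le_norm _ _) hC.nonneg)
  rcases (norm_nonneg (C x - C y)).eq_or_lt with h0 | h0
  · rw [← h0]
    exact mul_nonneg hC.nonneg (norm_nonneg _)
  · nlinarith

/-! ### Hilbert-space inequalities behind the descent -/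

/-- The three-point estimate for a cocoercive increment `c` along `e₁`. -/
theorem neg_two_mul_inner_le_of_cocoercive {β : ℝ} (hβ : 0 ≤ β) {c e₁ e₂ : H}
    (hc : ‖c‖ ^ 2 ≤ β * inner ℝ c e₁) :
    -(2 * inner ℝ c e₂) ≤ β / 2 * ‖e₂ - e₁‖ ^ 2 := by
  rcases hβ.eq_or_lt with rfl | hβ
  · have : c = 0 := by
      rw [← norm_eq_zero]
      nlinarith [norm_nonneg c]
    simp [this]
  -- Complete the square: expand ‖c + (β/2)(e₂ - e₁)‖² ≥ 0, bound ‖c‖² by `hc`, divide by β.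
  · have h := norm_add_sq_real c ((β / 2) • (e₂ - e₁))
    have h0 := sq_nonneg ‖c + (β / 2) • (e₂ - e₁)‖
    rw [inner_smul_right, norm_smul, mul_pow, Real.norm_eq_abs, sq_abs, inner_sub_right] at h
    have : 0 ≤ β * (inner ℝ c e₂ + β / 4 * ‖e₂ - e₁‖ ^ 2) := by nlinarith
    have := nonneg_of_mul_nonneg_right this hβ
    linarith

theorem two_mul_abs_inner_le (x y : H) : 2 * |inner ℝ x y| ≤ ‖x‖ ^ 2 + ‖y‖ ^ 2 := by
  nlinarith [abs_real_inner_le_norm x y, sq_nonneg (‖x‖ - ‖y‖)]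

/-- One step of the Lyapunov analysis, in terms of the errors `e₀`, `e₁`, `e₂` of three
consecutive iterates. -/
theorem lyapunov_step {e₀ e₁ e₂ c d₁ d₂ r : H} {a₀ a₁ θ δ β : ℝ} (ha₀ : 0 ≤ a₀) (ha₁ : 0 ≤ a₁)
    (hδ : 0 ≤ δ)
    (hβ : 0 ≤ β) (hr : a₁ • r = θ • (e₁ - e₀) - (e₂ - e₁) + a₁ • d₂ - a₀ • d₁)
    (hm : 0 ≤ inner ℝ (r - c) e₂) (hc : ‖c‖ ^ 2 ≤ β * inner ℝ c e₁)
    (hd : ‖d₁‖ ≤ δ * ‖e₁ - e₀‖) :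
    ‖e₂‖ ^ 2 - θ * ‖e₁‖ ^ 2 - 2 * a₁ * inner ℝ d₂ e₂
        + (1 - |θ| - a₀ * δ - a₁ * β / 2) * ‖e₂ - e₁‖ ^ 2
      ≤ ‖e₁‖ ^ 2 - θ * ‖e₀‖ ^ 2 - 2 * a₀ * inner ℝ d₁ e₁
        + (θ + |θ| + a₀ * δ) * ‖e₁ - e₀‖ ^ 2 := by
  have hm' : 0 ≤ inner ℝ (a₁ • r) e₂ - a₁ * inner ℝ c e₂ := by
    have := mul_nonneg ha₁ hm
    rwa [inner_sub_left, mul_sub, ← real_inner_smul_left] at this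
  rw [hr] at hm'
  have hC := mul_le_mul_of_nonneg_left (neg_two_mul_inner_le_of_cocoercive hβ hc (e₂ := e₂)) ha₁
  have hT : 2 * (θ * inner ℝ (e₁ - e₀) (e₂ - e₁))
      ≤ |θ| * (‖e₁ - e₀‖ ^ 2 + ‖e₂ - e₁‖ ^ 2) := by
    have h1 := mul_le_mul_of_nonneg_left (two_mul_abs_inner_le (e₁ - e₀) (e₂ - e₁)) (abs_nonneg θ)
    have h2 := le_abs_self (θ * inner ℝ (e₁ - e₀) (e₂ - e₁))
    rw [abs_mul] at h2
    linarith
  have hD : -(2 * (a₀ * inner ℝ d₁ (e₂ - e₁)))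
      ≤ a₀ * (δ * (‖e₁ - e₀‖ ^ 2 + ‖e₂ - e₁‖ ^ 2)) := by
    have h1 := neg_le_of_abs_le (abs_real_inner_le_norm d₁ (e₂ - e₁))
    have h2 := mul_le_mul_of_nonneg_right hd (norm_nonneg (e₂ - e₁))
    have h3 : 2 * (δ * ‖e₁ - e₀‖ * ‖e₂ - e₁‖) ≤ δ * (‖e₁ - e₀‖ ^ 2 + ‖e₂ - e₁‖ ^ 2) := by
      nlinarith [mul_nonneg hδ (sq_nonneg (‖e₁ - e₀‖ - ‖e₂ - e₁‖))]
    nlinarith [mul_le_mul_of_nonneg_left (h3.trans' (mul_le_mul_of_nonneg_left h2 two_pos.le)) ha₀]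
  simp only [inner_sub_left, inner_sub_right, inner_add_left, real_inner_smul_left,
    ← real_inner_self_eq_norm_sq, real_inner_comm e₀ e₁,
    real_inner_comm e₁ e₂] at hm' hC hT hD ⊢
  linarith

/-! ### Weak convergence and Opial's lemma -/

theorem tendsto_zero_of_norm_sq {E ι : Type*} [NormedAddCommGroup E] {l : Filter ι} {f : ι → E}
    (hf : Tendsto (fun i => ‖f i‖ ^ 2) l (𝓝 0)) : Tendsto f l (𝓝 0) := by
  rw [tendsto_zero_iff_norm_tendsto_zero]
  simpa [Real.sqrt_sq (norm_nonneg _)] using hf.sqrt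

/-- `x i` tends to `z` weakly along `l`, tested against inner products. -/
def WeaklyTendsto {ι : Type*} (x : ι → H) (l : Filter ι) (z : H) : Prop :=
  ∀ w, Tendsto (fun i => inner ℝ (x i) w) l (𝓝 (inner ℝ z w))

/-- The inner product of a strongly null sequence with a bounded one is null. -/
theorem tendsto_inner_zero {ι : Type*} {l : Filter ι} {f g : ι → H} {M : ℝ}
    (hf : Tendsto f l (𝓝 0)) (hg : ∀ i, ‖g i‖ ≤ M) :
    Tendsto (fun i => inner ℝ (f i) (g i)) l (𝓝 0) := by
  refine squeeze_zero_norm (fun i => ?_) (by simpa using hf.norm.mul_const M)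
  exact (norm_inner_le_norm _ _).trans (mul_le_mul_of_nonneg_left (hg i) (norm_nonneg _))

/-- Strong convergence against bounded weak convergence. -/
theorem WeaklyTendsto.tendsto_inner {ι : Type*} {l : Filter ι} {x v : ι → H} {z u : H} {M : ℝ}
    (hx : WeaklyTendsto x l z) (hM : ∀ i, ‖x i‖ ≤ M) (hv : Tendsto v l (𝓝 u)) :
    Tendsto (fun i => inner ℝ (v i) (x i)) l (𝓝 (inner ℝ u z)) := by
  have h1 : Tendsto (fun i => inner ℝ (v i - u) (x i)) l (𝓝 0) :=
    tendsto_inner_zero (by simpa using hv.sub_const u) hM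
  have h2 := h1.add (hx u)
  simp only [zero_add, real_inner_comm u] at h2
  refine h2.congr fun i => ?_
  rw [inner_sub_left]
  ring

theorem WeaklyTendsto.add_zero {ι : Type*} {l : Filter ι} {x y : ι → H} {z : H}
    (hx : WeaklyTendsto x l z) (hy : Tendsto y l (𝓝 0)) : WeaklyTendsto (x + y) l z := by
  intro w
  simpa [inner_add_left] using (hx w).add (hy.inner (tendsto_const_nhds (x := w)))

/-- The graph of a maximally monotone operator is closed for bounded weak-strong convergence. -/
theorem IsMaximallyMonotone.mem_of_tendsto {ι : Type*} {l : Filter ι} [l.NeBot]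
    {A : H → Set H} (hA : IsMaximallyMonotone A) {x v : ι → H} {z u : H} {M : ℝ}
    (hx : WeaklyTendsto x l z) (hM : ∀ i, ‖x i‖ ≤ M) (hv : Tendsto v l (𝓝 u))
    (h : ∀ i, v i ∈ A (x i)) : u ∈ A z := by
  refine hA.mem_of_forall fun y w hw => ?_
  have h1 := hx.tendsto_inner hM (hv.sub_const w)
  have h2 := h1.sub ((hv.sub_const w).inner (tendsto_const_nhds (x := y)))
  rw [inner_sub_right]
  refine ge_of_tendsto' h2 fun i => ?_
  rw [← inner_sub_right]
  exact hA.1 (x i, v i) (h i) (y, w) hw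

/-- A cocoercive operator maps a weakly convergent sequence with strongly convergent images to
the image of its limit. -/
theorem IsCocoercive.eq_of_tendsto {ι : Type*} {l : Filter ι} [l.NeBot] {β : ℝ} {C : H → H}
    (hC : IsCocoercive β C) {x : ι → H} {z u : H} {M : ℝ} (hx : WeaklyTendsto x l z)
    (hM : ∀ i, ‖x i‖ ≤ M) (hu : Tendsto (fun i => C (x i)) l (𝓝 u)) : C z = u := by
  have h1 := hx.tendsto_inner hM (hu.sub_const (C z))
  have h2 := (h1.sub ((hu.sub_const (C z)).inner (tendsto_const_nhds (x := z)))).const_mul β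
  have h3 := le_of_tendsto_of_tendsto' ((hu.sub_const (C z)).norm.pow 2) h2 fun i => by
    simpa only [inner_sub_right] using hC.sq_norm_sub_le (x i) z
  have h4 : ‖u - C z‖ = 0 := by
    rw [sub_self, mul_zero] at h3
    exact pow_eq_zero_iff two_ne_zero |>.1 (le_antisymm h3 (sq_nonneg _))
  exact (sub_eq_zero.1 (norm_eq_zero.1 h4)).symm

variable [CompleteSpace H]

/-- Bounded families in a Hilbert space converge weakly along ultrafilters. -/
theorem exists_weaklyTendsto {ι : Type*} (f : Ultrafilter ι) {x : ι → H} {M : ℝ}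
    (hM : ∀ i, ‖x i‖ ≤ M) : ∃ z, WeaklyTendsto x f z := by
  let g : ι → WeakDual ℝ H := fun i =>
    StrongDual.toWeakDual (InnerProductSpace.toDual ℝ H (x i))
  have hK := WeakDual.isCompact_closedBall (𝕜 := ℝ) (E := H) 0 M
  obtain ⟨φ, -, hφ⟩ := hK.ultrafilter_le_nhds' (f.map g) (by
    refine Ultrafilter.mem_map.2 (Filter.univ_mem' fun i => ?_)
    simpa [g] using hM i)
  refine ⟨(InnerProductSpace.toDual ℝ H).symm (WeakDual.toStrongDual φ), fun w => ?_⟩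
  have h1 := ((WeakDual.eval_continuous w).tendsto φ).comp hφ
  rw [InnerProductSpace.toDual_symm_apply]
  exact h1

/-- Opial's lemma. -/
theorem exists_weaklyTendsto_of_forall_ultrafilter {ι : Type*} {l : Filter ι} [l.NeBot]
    {S : Set H} {x : ι → H} {M : ℝ} (hM : ∀ i, ‖x i‖ ≤ M)
    (hS : ∀ s ∈ S, ∃ L, Tendsto (fun i => ‖x i - s‖ ^ 2) l (𝓝 L))
    (hx : ∀ f : Ultrafilter ι, ↑f ≤ l → ∀ z, WeaklyTendsto x f z → z ∈ S) :
    ∃ z ∈ S, WeaklyTendsto x l z := by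
  obtain ⟨z, hz⟩ := exists_weaklyTendsto (Ultrafilter.of l) hM
  have hzS := hx _ (Ultrafilter.of_le l) z hz
  refine ⟨z, hzS, fun w => ?_⟩
  rw [tendsto_iff_ultrafilter]
  intro f hf
  obtain ⟨z', hz'⟩ := exists_weaklyTendsto f hM
  obtain ⟨L, hL⟩ := hS z hzS
  obtain ⟨L', hL'⟩ := hS z' (hx f hf z' hz')
  -- ‖x i - z'‖² - ‖x i - z‖² is affine in ⟪x i, z - z'⟫, which therefore converges along all of l.
  -- Its limits along the two ultrafilters agree, forcing ‖z - z'‖² = 0.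
  have h1 : Tendsto (fun i => inner ℝ (x i) (z - z')) l
      (𝓝 ((L' - L + ‖z‖ ^ 2 - ‖z'‖ ^ 2) / 2)) := by
    refine ((((hL'.sub hL).add_const (‖z‖ ^ 2)).sub_const (‖z'‖ ^ 2)).div_const 2).congr
      fun i => ?_
    rw [norm_sub_sq_real, norm_sub_sq_real, inner_sub_right]
    ring
  have h2 := tendsto_nhds_unique (hz (z - z')) (h1.mono_left (Ultrafilter.of_le l))
  have h3 := tendsto_nhds_unique (hz' (z - z')) (h1.mono_left hf)
  have h4 : z = z' := by
    rw [← sub_eq_zero, ← inner_self_eq_zero (𝕜 := ℝ), inner_sub_left, h2, h3, sub_self]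
  rw [h4]
  exact hz' w

theorem WeaklyTendsto.convergesWeakly {x : ℤ → H} {z : H}
    (h : WeaklyTendsto (fun n : ℕ => x n) atTop z) : ConvergesWeakly x z := by
  refine (WeakBilin.tendsto_iff_forall_eval_tendsto (topDualPairing ℝ H).flip ?_).2 fun φ => ?_
  · intro a b hab
    refine ext_inner_left ℝ fun w => ?_
    simpa using congrArg (fun L => L (InnerProductSpace.toDual ℝ H w)) hab
  · have := h ((InnerProductSpace.toDual ℝ H).symm φ)
    simp only [real_inner_comm ((InnerProductSpace.toDual ℝ H).symm φ),
      InnerProductSpace.toDual_symm_apply] at this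
    exact this

end FHRB

/-! ### Lyapunov analysis of the iteration -/

namespace FHRB

variable {H : Type*} [NormedAddCommGroup H] [InnerProductSpace ℝ H]

/-- `y` is generated by forward-half-reflected-backward splitting with momentum, where `v n` is the
element of `A (y (n + 2))` (with `A = B + D`) selected by the resolvent. -/
structure IsIteration (A : H → Set H) (D C : H → H) (δ : ℝ≥0) (β θ ε : ℝ) (a : ℕ → ℝ)
    (y v : ℕ → H) : Prop where
  maximal : IsMaximallyMonotone A
  lipschitz : LipschitzWith δ D
  cocoercive : IsCocoercive β C
  theta_lt : θ < 1
  eps_pos : 0 < ε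
  eps_le : ∀ n, ε ≤ a n
  step_le : ∀ n, a n * δ + a (n + 1) * (δ + β / 2) ≤ 1 - θ - 2 * |θ| - ε
  mem : ∀ n, v n ∈ A (y (n + 2))
  smul_eq : ∀ n, a (n + 1) • (v n + C (y (n + 1))) =
    θ • (y (n + 1) - y n) - (y (n + 2) - y (n + 1)) + a (n + 1) • (D (y (n + 2)) - D (y (n + 1)))
      - a n • (D (y (n + 1)) - D (y n))

/-- The Lyapunov function. -/
noncomputable def energy (D : H → H) (δ : ℝ≥0) (θ : ℝ) (a : ℕ → ℝ) (y : ℕ → H) (s : H) (n : ℕ) :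
    ℝ :=
  ‖y (n + 1) - s‖ ^ 2 - θ * ‖y n - s‖ ^ 2
    - 2 * a n * inner ℝ (D (y (n + 1)) - D (y n)) (y (n + 1) - s)
    + (θ + |θ| + a n * δ) * ‖y (n + 1) - y n‖ ^ 2

namespace IsIteration

variable {A : H → Set H} {D C : H → H} {δ : ℝ≥0} {β θ ε : ℝ} {a : ℕ → ℝ} {y v : ℕ → H}

theorem pos (h : IsIteration A D C δ β θ ε a y v) (n : ℕ) : 0 < a n :=
  h.eps_pos.trans_le (h.eps_le n)

theorem mul_le (h : IsIteration A D C δ β θ ε a y v) (n : ℕ) :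
    a n * δ ≤ 1 - θ - 2 * |θ| - ε := by
  have := mul_nonneg (h.pos (n + 1)).le (add_nonneg δ.2
    (div_nonneg h.cocoercive.nonneg two_pos.le))
  have h1 := h.step_le n
  simp only [NNReal.val_eq_coe] at this
  linarith

theorem inner_nonneg (h : IsIteration A D C δ β θ ε a y v) {s : H} (hs : -C s ∈ A s) (n : ℕ) :
    0 ≤ inner ℝ (v n + C (y (n + 1)) - (C (y (n + 1)) - C s)) (y (n + 2) - s) := by
  have := h.maximal.1 (y (n + 2), v n) (h.mem n) (s, -C s) hs
  rwa [sub_neg_eq_add, show v n + C s = v n + C (y (n + 1)) - (C (y (n + 1)) - C s) by abel]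
    at this

theorem energy_succ_le (h : IsIteration A D C δ β θ ε a y v) {s : H} (hs : -C s ∈ A s) (n : ℕ) :
    energy D δ θ a y s (n + 1) + ε * ‖y (n + 2) - y (n + 1)‖ ^ 2 ≤ energy D δ θ a y s n := by
  have key := lyapunov_step (e₀ := y n - s) (e₁ := y (n + 1) - s) (e₂ := y (n + 2) - s)
    (c := C (y (n + 1)) - C s) (d₁ := D (y (n + 1)) - D (y n))
    (d₂ := D (y (n + 2)) - D (y (n + 1))) (r := v n + C (y (n + 1))) (θ := θ)
    (h.pos n).le (h.pos (n + 1)).le δ.2 h.cocoercive.nonneg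
    (by simpa using h.smul_eq n) (h.inner_nonneg hs n) (h.cocoercive.sq_norm_sub_le _ _)
    (by simpa using h.lipschitz.norm_sub_le (y (n + 1)) (y n))
  simp only [sub_sub_sub_cancel_right, NNReal.val_eq_coe] at key
  have h1 := mul_le_mul_of_nonneg_right (h.step_le n) (sq_nonneg ‖y (n + 2) - y (n + 1)‖)
  simp only [energy, add_assoc, Nat.reduceAdd]
  linarith

theorem norm_smul_sub_le (h : IsIteration A D C δ β θ ε a y v) (n : ℕ) :
    ‖a n • (D (y (n + 1)) - D (y n))‖ ≤ a n * δ * ‖y (n + 1) - y n‖ := by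
  rw [norm_smul, Real.norm_of_nonneg (h.pos n).le, mul_assoc]
  exact mul_le_mul_of_nonneg_left (h.lipschitz.norm_sub_le _ _) (h.pos n).le

/-- Young's inequality on the cross term costs aₙδ(‖yₙ₊₁ - yₙ‖² + ‖yₙ₊₁ - s‖²). The first part is
absorbed by the increment term of the energy, and 1 - aₙδ ≥ |θ| + ε handles the second. -/
theorem mul_sq_norm_le (h : IsIteration A D C δ β θ ε a y v) (s : H) (n : ℕ) :
    (|θ| + ε) * ‖y (n + 1) - s‖ ^ 2 ≤ energy D δ θ a y s n + |θ| * ‖y n - s‖ ^ 2 := by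
  have h1 := (real_inner_le_norm (a n • (D (y (n + 1)) - D (y n))) (y (n + 1) - s)).trans
    (mul_le_mul_of_nonneg_right (h.norm_smul_sub_le n) (norm_nonneg _))
  rw [real_inner_smul_left] at h1
  have h2 := mul_nonneg (mul_nonneg (h.pos n).le δ.2)
    (sq_nonneg (‖y (n + 1) - y n‖ - ‖y (n + 1) - s‖))
  simp only [NNReal.val_eq_coe] at h2
  have h3 : 0 ≤ (θ + |θ|) * ‖y (n + 1) - y n‖ ^ 2 :=
    mul_nonneg (by linarith [neg_abs_le θ]) (sq_nonneg _)
  have h4 : 0 ≤ (1 - a n * δ - |θ| - ε) * ‖y (n + 1) - s‖ ^ 2 :=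
    mul_nonneg (by linarith [h.mul_le n, neg_abs_le θ]) (sq_nonneg _)
  have h5 : θ * ‖y n - s‖ ^ 2 ≤ |θ| * ‖y n - s‖ ^ 2 :=
    mul_le_mul_of_nonneg_right (le_abs_self θ) (sq_nonneg _)
  rw [energy]
  linarith

theorem energy_antitone (h : IsIteration A D C δ β θ ε a y v) {s : H} (hs : -C s ∈ A s) :
    Antitone (energy D δ θ a y s) :=
  antitone_nat_of_succ_le fun n => by
    have := h.energy_succ_le hs n
    have := mul_nonneg h.eps_pos.le (sq_nonneg ‖y (n + 2) - y (n + 1)‖)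
    linarith

theorem exists_sq_norm_le (h : IsIteration A D C δ β θ ε a y v) {s : H} (hs : -C s ∈ A s) :
    ∃ M, ∀ n, ‖y n - s‖ ^ 2 ≤ M := by
  -- This M satisfies energy₀ ≤ εM, so the induction closes as (|θ| + ε)‖yₙ₊₁ - s‖² ≤ εM + |θ|M.
  refine ⟨max (‖y 0 - s‖ ^ 2) (energy D δ θ a y s 0 / ε), fun n => ?_⟩
  set M := max (‖y 0 - s‖ ^ 2) (energy D δ θ a y s 0 / ε)
  induction n with
  | zero => exact le_max_left _ _
  | succ n ih =>
    have h1 := h.mul_sq_norm_le s n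
    have h2 := h.energy_antitone hs (Nat.zero_le n)
    have h3 : energy D δ θ a y s 0 ≤ M * ε := (div_le_iff₀ h.eps_pos).1 (le_max_right _ _)
    have h4 := mul_le_mul_of_nonneg_left ih (abs_nonneg θ)
    have h5 : (|θ| + ε) * ‖y (n + 1) - s‖ ^ 2 ≤ (|θ| + ε) * M := by linarith
    exact le_of_mul_le_mul_left h5 (add_pos_of_nonneg_of_pos (abs_nonneg θ) h.eps_pos)

theorem exists_norm_sub_le (h : IsIteration A D C δ β θ ε a y v) {s : H} (hs : -C s ∈ A s) :
    ∃ M, ∀ n, ‖y n - s‖ ≤ M := by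
  obtain ⟨M, hM⟩ := h.exists_sq_norm_le hs
  exact ⟨√M, fun n => Real.le_sqrt_of_sq_le (hM n)⟩

theorem exists_tendsto_energy (h : IsIteration A D C δ β θ ε a y v) {s : H} (hs : -C s ∈ A s) :
    ∃ L, Tendsto (energy D δ θ a y s) atTop (𝓝 L) := by
  obtain ⟨M, hM⟩ := h.exists_sq_norm_le hs
  refine ⟨_, tendsto_atTop_ciInf (h.energy_antitone hs) ⟨-(|θ| * M), ?_⟩⟩
  rintro _ ⟨n, rfl⟩
  have h1 := h.mul_sq_norm_le s n
  have h2 := mul_le_mul_of_nonneg_left (hM n) (abs_nonneg θ)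
  have h3 := mul_nonneg (add_nonneg (abs_nonneg θ) h.eps_pos.le) (sq_nonneg ‖y (n + 1) - s‖)
  linarith

theorem tendsto_sub (h : IsIteration A D C δ β θ ε a y v) {s : H} (hs : -C s ∈ A s) :
    Tendsto (fun n => y (n + 1) - y n) atTop (𝓝 0) := by
  obtain ⟨L, hL⟩ := h.exists_tendsto_energy hs
  refine (tendsto_add_atTop_iff_nat 1).1 (tendsto_zero_of_norm_sq ?_)
  have h1 := (hL.sub ((tendsto_add_atTop_iff_nat 1).2 hL)).div_const ε
  rw [sub_self, zero_div] at h1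
  refine squeeze_zero (fun n => sq_nonneg _) (fun n => ?_) h1
  rw [le_div_iff₀ h.eps_pos, mul_comm]
  have := h.energy_succ_le hs n
  simp only [add_assoc, Nat.reduceAdd]
  linarith

theorem tendsto_smul_sub (h : IsIteration A D C δ β θ ε a y v) {s : H} (hs : -C s ∈ A s) :
    Tendsto (fun n => a n • (D (y (n + 1)) - D (y n))) atTop (𝓝 0) := by
  refine squeeze_zero_norm (fun n => (h.norm_smul_sub_le n).trans
    (mul_le_mul_of_nonneg_right (h.mul_le n) (norm_nonneg _))) ?_
  simpa using (h.tendsto_sub hs).norm.const_mul (1 - θ - 2 * |θ| - ε)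

/-- Since increments vanish and iterates are bounded, the energy differs from (1 - θ)‖yₙ - s‖² by a
null sequence, and θ < 1. -/
theorem exists_tendsto_sq_norm (h : IsIteration A D C δ β θ ε a y v) {s : H} (hs : -C s ∈ A s) :
    ∃ L, Tendsto (fun n => ‖y n - s‖ ^ 2) atTop (𝓝 L) := by
  obtain ⟨L, hL⟩ := h.exists_tendsto_energy hs
  obtain ⟨M, hM⟩ := h.exists_norm_sub_le hs
  have hp := h.tendsto_sub hs
  have h1 := (tendsto_inner_zero (h.tendsto_smul_sub hs) fun n => hM (n + 1)).const_mul 2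
  have h2 : Tendsto (fun n => (θ + |θ| + a n * δ) * ‖y (n + 1) - y n‖ ^ 2) atTop (𝓝 0) := by
    refine squeeze_zero (fun n => mul_nonneg ?_ (sq_nonneg _))
      (fun n => mul_le_mul_of_nonneg_right (a := ‖y (n + 1) - y n‖ ^ 2)
        (add_le_add_right (h.mul_le n) (θ + |θ|)) (sq_nonneg _))
      (by simpa using (hp.norm.pow 2).const_mul (θ + |θ| + (1 - θ - 2 * |θ| - ε)))
    exact add_nonneg (by linarith [neg_abs_le θ]) (mul_nonneg (h.pos n).le δ.2)
  have h3 : Tendsto (fun n => inner ℝ (y (n + 1) - y n) ((y (n + 1) - s) + (y n - s)))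
      atTop (𝓝 0) :=
    tendsto_inner_zero (M := M + M) hp fun n =>
      (norm_add_le _ _).trans (add_le_add (hM (n + 1)) (hM n))
  refine ⟨_, ((((hL.add h1).sub h2).sub h3).div_const (1 - θ)).congr fun n => ?_⟩
  have h4 : inner ℝ (y (n + 1) - y n) ((y (n + 1) - s) + (y n - s))
      = ‖y (n + 1) - s‖ ^ 2 - ‖y n - s‖ ^ 2 := by
    have : y (n + 1) - y n = (y (n + 1) - s) - (y n - s) := by abel
    rw [this, inner_sub_left, inner_add_right, inner_add_right, real_inner_self_eq_norm_sq,
      real_inner_self_eq_norm_sq, real_inner_comm]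
    ring
  rw [h4, div_eq_iff (by linarith [h.theta_lt]), energy, real_inner_smul_left]
  ring

theorem tendsto_residual (h : IsIteration A D C δ β θ ε a y v) {s : H} (hs : -C s ∈ A s) :
    Tendsto (fun n => v n + C (y (n + 1))) atTop (𝓝 0) := by
  have hp := h.tendsto_sub hs
  have hd := h.tendsto_smul_sub hs
  have h1 := ((((hp.const_smul θ).sub ((tendsto_add_atTop_iff_nat 1).2 hp)).add
    ((tendsto_add_atTop_iff_nat 1).2 hd)).sub hd).norm.const_mul ε⁻¹
  simp only [smul_zero, sub_zero, add_zero, norm_zero, mul_zero] at h1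
  refine squeeze_zero_norm (fun n => ?_) h1
  have h2 := h.smul_eq n
  simp only [add_assoc, Nat.reduceAdd] at h2 ⊢
  rw [← h2, norm_smul, Real.norm_of_nonneg (h.pos _).le, le_inv_mul_iff₀ h.eps_pos]
  exact mul_le_mul_of_nonneg_right (h.eps_le _) (norm_nonneg _)

/-- Monotonicity bounds ⟪C yₙ₊₁ - C s, yₙ₊₂ - s⟫ by the residual paired with a bounded sequence.
Replacing yₙ₊₂ by yₙ₊₁ costs a null term, and cocoercivity turns the bound into one on ‖C yₙ₊₁ - C
s‖². -/
theorem tendsto_cocoercive (h : IsIteration A D C δ β θ ε a y v) {s : H} (hs : -C s ∈ A s) :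
    Tendsto (fun n => C (y n)) atTop (𝓝 (C s)) := by
  obtain ⟨M, hM⟩ := h.exists_norm_sub_le hs
  refine (tendsto_add_atTop_iff_nat 1).1 (tendsto_sub_nhds_zero_iff.1 (tendsto_zero_of_norm_sq ?_))
  have h1 := tendsto_inner_zero (h.tendsto_residual hs) fun n => hM (n + 2)
  have h2 := tendsto_inner_zero ((tendsto_add_atTop_iff_nat 1).2 (h.tendsto_sub hs))
    (g := fun n => C (y (n + 1)) - C s) (M := β * M) fun n =>
      (h.cocoercive.norm_sub_le _ _).trans
        (mul_le_mul_of_nonneg_left (hM _) h.cocoercive.nonneg)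
  have h3 := (h1.sub h2).const_mul β
  simp only [sub_zero, mul_zero, add_assoc, Nat.reduceAdd] at h3
  refine squeeze_zero (fun n => sq_nonneg _) (fun n => ?_) h3
  refine (h.cocoercive.sq_norm_sub_le _ _).trans
    (mul_le_mul_of_nonneg_left ?_ h.cocoercive.nonneg)
  have h4 := h.inner_nonneg hs n
  rw [inner_sub_left] at h4
  have h5 : y (n + 2) - s = (y (n + 1) - s) + (y (n + 2) - y (n + 1)) := by abel
  have h6 : inner ℝ (C (y (n + 1)) - C s) (y (n + 2) - s)
      = inner ℝ (C (y (n + 1)) - C s) (y (n + 1) - s)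
        + inner ℝ (y (n + 2) - y (n + 1)) (C (y (n + 1)) - C s) := by
    rw [h5, inner_add_right, real_inner_comm (y (n + 2) - y (n + 1))]
  linarith

/-- Weak limits of the iterates along ultrafilters are solutions. -/
theorem mem_of_weaklyTendsto (h : IsIteration A D C δ β θ ε a y v) {s : H} (hs : -C s ∈ A s)
    {f : Ultrafilter ℕ} (hf : ↑f ≤ (atTop : Filter ℕ)) {z : H} (hz : WeaklyTendsto y f z)
    {M : ℝ} (hM : ∀ n, ‖y n‖ ≤ M) : -C z ∈ A z := by
  have hp := h.tendsto_sub hs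
  have hCz : C z = C s := h.cocoercive.eq_of_tendsto hz hM ((h.tendsto_cocoercive hs).mono_left hf)
  have hz2 : WeaklyTendsto (fun n => y (n + 2)) f z := by
    have h1 := (hp.add ((tendsto_add_atTop_iff_nat 1).2 hp)).mono_left hf
    rw [add_zero] at h1
    convert hz.add_zero h1 using 2 with n
    simp only [Pi.add_apply, add_assoc, Nat.reduceAdd]
    abel
  have hv : Tendsto v atTop (𝓝 (-C s)) := by
    have h1 := (h.tendsto_residual hs).sub
      ((tendsto_add_atTop_iff_nat 1).2 (h.tendsto_cocoercive hs))
    simpa using h1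
  rw [hCz]
  exact h.maximal.mem_of_tendsto hz2 (fun n => hM (n + 2)) (hv.mono_left hf) h.mem

theorem exists_weaklyTendsto [CompleteSpace H] (h : IsIteration A D C δ β θ ε a y v)
    (hne : ∃ s, -C s ∈ A s) : ∃ z, -C z ∈ A z ∧ WeaklyTendsto y atTop z := by
  obtain ⟨s, hs⟩ := hne
  obtain ⟨M, hM⟩ := h.exists_norm_sub_le hs
  have hM' : ∀ n, ‖y n‖ ≤ M + ‖s‖ := fun n => by
    have := norm_sub_norm_le (y n) s
    linarith [hM n]
  exact exists_weaklyTendsto_of_forall_ultrafilter (S := {s | -C s ∈ A s}) hM'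
    (fun t ht => h.exists_tendsto_sq_norm ht)
    fun f hf z hz => h.mem_of_weaklyTendsto hs hf hz hM'

end IsIteration

/-! ### Application to the two algorithms -/

/-- Weak convergence of forward-half-reflected-backward splitting with momentum. -/
theorem IsFHRBMomentum.exists_convergesWeakly [CompleteSpace H] {B : H → Set H} {D C : H → H}
    {δ : ℝ≥0} {β : ℝ} (hA : Assumptions B D C δ β) {θ : ℝ} (hθ : θ < 1) {α : ℤ → ℝ} {ε : ℝ}
    (hε : 0 < ε) (hα : ∀ k : ℕ, ε ≤ α k ∧
      α k * δ + α (k + 1) * (δ + β / 2) ≤ (1 - θ - 2 * |θ|) - ε) {x : ℤ → H}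
    (hx : IsFHRBMomentum B D C θ α x) :
    ∃ z ∈ zer (B + toSetValued D + toSetValued C), ConvergesWeakly x z := by
  -- The update at k = 0 is dropped: it involves x₋₁ and α₋₁, which the step-size bound does not
  -- control. Convergence is unaffected.
  choose u hu hux using fun n : ℕ => mem_resolvent.1 (hx (n + 1))
  have hit : IsIteration (B + toSetValued D) D C δ β θ ε (fun n => α n) (fun n => x n)
      (fun n => u n + D (x ((n + 2 : ℕ) : ℤ))) := by
    refine ⟨hA.maximal_add, hA.lipschitz_D, hA.cocoercive_C, hθ, hε, fun n => (hα n).1,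
      fun n => by simpa using (hα n).2, fun n => ?_, fun n => ?_⟩
    · have := hu n
      rw [mem_add_toSetValued, add_sub_cancel_right]
      rwa [show ((n + 1 : ℕ) : ℤ) + 1 = ((n + 2 : ℕ) : ℤ) by push_cast; ring] at this
    · have := hux n
      have e1 : ((n + 1 : ℕ) : ℤ) + 1 = n + 2 := by push_cast; ring
      have e2 : ((n + 1 : ℕ) : ℤ) - 1 = n := by push_cast; ring
      rw [e1, e2] at this
      push_cast at this ⊢
      rw [smul_add, smul_add, this]
      module
  obtain ⟨z, hz, hxz⟩ := hit.exists_weaklyTendsto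
    (hA.zer_nonempty.imp fun s hs => mem_zer_add_toSetValued.1 hs)
  exact ⟨z, mem_zer_add_toSetValued.2 hz, hxz.convergesWeakly⟩

theorem add_toSetValued_zero {E : Type*} [NormedAddCommGroup E] (B : E → Set E) :
    B + toSetValued (0 : E → E) = B := by
  ext x u
  rw [mem_add_toSetValued, Pi.zero_apply, sub_zero]

/-- Weak convergence of forward-backward splitting with momentum. -/
theorem IsFBMomentum.exists_convergesWeakly [CompleteSpace H] {B : H → Set H} {C : H → H}
    {β : ℝ} (hB : IsMaximallyMonotone B) (hC : IsCocoercive β C)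
    (hne : (zer (B + toSetValued C)).Nonempty) {θ : ℝ} (hθ : θ < 1) {α : ℕ → ℝ} {ε : ℝ}
    (hε : 0 < ε) (hα : ∀ k, ε ≤ α k ∧ α k * (β / 2) ≤ (1 - θ - 2 * |θ|) - ε) {x : ℤ → H}
    (hx : IsFBMomentum B C θ α x) :
    ∃ z ∈ zer (B + toSetValued C), ConvergesWeakly x z := by
  have hA : Assumptions B 0 C 0 β :=
    ⟨hB, LipschitzWith.const 0, by rwa [add_toSetValued_zero], hC,
      by rwa [add_toSetValued_zero]⟩
  have h := IsFHRBMomentum.exists_convergesWeakly hA hθ (α := fun k => α k.toNat) hε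
    (fun k => ⟨by simpa using (hα k).1, ?_⟩) (x := x) fun k => ?_
  · rwa [add_toSetValued_zero] at h
  · have e : ((k : ℤ) + 1).toNat = k + 1 := rfl
    simpa [e] using (hα (k + 1)).2
  · simpa using hx k

end FHRB

theorem corollary5p3 {H : Type*} [NormedAddCommGroup H] [InnerProductSpace ℝ H]
    [CompleteSpace H] :
    (∀ (B : H → Set H) (D C : H → H) (δ : ℝ≥0) (β : ℝ), FHRB.Assumptions B D C δ β →
      ∀ θ : ℝ, θ < 1 → ∀ α : ℤ → ℝ, 0 < α (-1) →
      (∃ ε : ℝ, 0 < ε ∧ ∀ k : ℕ, ε ≤ α k ∧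
        α k * δ + α (k + 1) * (δ + β / 2) ≤ (1 - θ - 2 * |θ|) - ε) →
      ∀ x : ℤ → H, FHRB.IsFHRBMomentum B D C θ α x →
        ∃ z ∈ FHRB.zer (B + FHRB.toSetValued D + FHRB.toSetValued C),
          FHRB.ConvergesWeakly x z) ∧
    (∀ θ : ℝ, -1 < θ → θ < 1 / 3 → ∀ β : ℝ, 0 ≤ β → ∃ a : ℝ, 0 < a ∧
      ∀ (B : H → Set H) (C : H → H), FHRB.IsMaximallyMonotone B → FHRB.IsCocoercive β C →
      (FHRB.zer (B + FHRB.toSetValued C)).Nonempty →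
      ∀ α : ℕ → ℝ, (∃ ε : ℝ, 0 < ε ∧ ∀ k, ε ≤ α k) → (∀ k, α k ≤ a) →
      ∀ x : ℤ → H, FHRB.IsFBMomentum B C θ α x →
        ∃ z ∈ FHRB.zer (B + FHRB.toSetValued C), FHRB.ConvergesWeakly x z) := by

  refine ⟨?_, ?_⟩
  · rintro B D C δ β hA θ hθ α - ⟨ε, hε, hα⟩ x hx
    exact hx.exists_convergesWeakly hA hθ hε hα
  · intro θ hθ hθ' β hβ
    have hη : 0 < 1 - θ - 2 * |θ| := by
      rcases abs_cases θ with h | h <;> linarith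
    -- With η = 1 - θ - 2|θ|, positive exactly on (-1, 1/3), this gives αₖβ/2 ≤ η/2; β + 1 also
    -- covers β = 0. The other η/2 pays for min(ε, η/2).
    refine ⟨(1 - θ - 2 * |θ|) / (β + 1), div_pos hη (by linarith), ?_⟩
    rintro B C hB hC hne α ⟨ε, hε, hα⟩ hα' x hx
    refine hx.exists_convergesWeakly hB hC hne (by linarith)
      (lt_min hε (half_pos hη)) fun k => ⟨(min_le_left _ _).trans (hα k), ?_⟩
    have h1 := (le_div_iff₀ (by linarith : 0 < β + 1)).1 (hα' k)
    have h2 := min_le_right ε ((1 - θ - 2 * |θ|) / 2)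
    linarith [hα k]
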